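/- Let $n,t\in\mathbb N$ with $1\le t\le\lfloor n/2\rfloor$, let $\epsilon_1>0$, $\epsilon_2\ge 0$, $\delta\in[0,1]$, $c\ge 0$. The input is a matrix $A=(a_{i,j})\in\{0,1\}^{n\times n}$; row $i$ is the neighbor list of user $i$, and $d_i=\sum_j a_{i,j}$. A graph $G$ on $[n]$ is identified with its adjacency matrix. For $\epsilon\ge0$ let $\mathcal R_\epsilon$ be Warner's randomized response, which keeps a bit with probability $\frac{e^\epsilon}{e^\epsilon+1}$ and flips it otherwise. **Local budget.** For $m=n-2$ let $\epsilon_L\ge0$ be such that $\epsilon_2$ is the closed-form or a numerical upper bound for privacy amplification by shuffling $m$ users of budget $\epsilon_L$, i.e. one of the following holds. * (Closed form) $m>0$, $\delta>0$, $\epsilon_L\le\log\frac{m}{16\log(2/\delta)}$ and $$\epsilon_2=\log\Bigl(1+\tfrac{e^{\epsilon_L}-1}{e^{\epsilon_L}+1}\Bigl(\tfrac{8\sqrt{e^{\epsilon_L}\log(4/\delta)}}{\sqrt m}+\tfrac{8e^{\epsilon_L}}{m}\Bigr)\Bigr).$$ * (Numerical) The laws $P$ of $(X+B,\,C-X+1-B)$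 and $Q$ of $(X+1-B,\,C-X+B)$ are $(\epsilon_2,\delta)$-indistinguishable, i.e. $P(S)\le e^{\epsilon_2}Q(S)+\delta$ and $Q(S)\le e^{\epsilon_2}P(S)+\delta$ for all $S$, where $C\sim\mathrm{Bin}(\max(m-1,0),e^{-\epsilon_L})$, $X\sim\mathrm{Bin}(C,\frac12)$ given $C$, and $B\sim\mathrm{Ber}\bigl(\frac{e^{\epsilon_L}}{e^{\epsilon_L}+1}\bigr)$ is independent of $(C,X)$. **Algorithm $\mathsf{WShuffle}^*_\triangle$.** All randomness is independent unless stated otherwise. 1. The data collector samples a uniform random permutation $\sigma$ of $[n]$ and forms the $t$ disjoint pairs $(\sigma(1),\sigma(2)),\dots,(\sigma(2t-1),\sigma(2t))$. 2. For each such pair $(i,j)$, every user $k\ne i,j$ computes $y_k=\mathcal R_{\epsilon_L}(a_{k,i}a_{k,j})$, and the data collector receives the family $(y_{\pi(k)})_{k\ne i,j}$ for a uniform random permutation $\pi$ of $[n]\setminus\{i,j\}$; it also receives $z_i=\mathcal R_{\epsilon_2}(a_{i,j})$ and $z_j=\mathcal R_{\epsilon_2}(a_{j,i})$. With $q=\frac1{e^{\epsilon_2}+1}$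 and $q_L=\frac1{e^{\epsilon_L}+1}$ it computes $$\hat f_{i,j}=\frac{(z_i+z_j-2q)\sum_{k\ne i,j}(y_k-q_L)}{2(1-2q)(1-2q_L)}$$ (read as $0$ if the denominator is $0$). 3. Every user $i\in[n]$ sends $\tilde d_i=d_i+\mathrm{Lap}(1/\epsilon_1)$. 4. With $D$ the set of $i\in\{1,3,\dots,2t-1\}$ with $\min\{\tilde d_{\sigma(i)},\tilde d_{\sigma(i+1)}\}>c\cdot\frac1n\sum_{k=1}^n\tilde d_k$, the data collector outputs $\hat f=\frac{n(n-1)}{6t}\sum_{i\in D}\hat f_{\sigma(i),\sigma(i+1)}$. **Claim.** The algorithm, with output $\hat f$, provides $(\epsilon_1+\epsilon_2,\delta)$-element DP and $(2(\epsilon_1+\epsilon_2),2\delta)$-edge DP. The same holds when the output is the whole transcript received by the data collector ($\sigma$, all shuffled noisy wedges, all $z_i,z_j$, and all $\tilde d_i$). Here a randomized algorithm $M$ provides $(\epsilon,\delta)$-element DP if $\Pr[M(A)\in S]\le e^\epsilon\Pr[M(A')\in S]+\delta$ for every measurable $S$ and all $A,A'\in\{0,1\}^{n\times n}$ that differ in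 exactly one entry, and $(\epsilon,\delta)$-edge DP if the same inequality holds for the (symmetric) adjacency matrices $A,A'$ of any two simple undirected graphs on $[n]$ that differ in exactly one edge. -/

import Mathlib

noncomputable section

namespace WedgeShuffle

open MeasureTheory

/-! ### Approximate indistinguishability, element DP and edge DP -/

/-- `μ S ≤ e^ε ν S + δ` for every event `S`. -/
def Indist {Ω : Type*} [MeasurableSpace Ω] (μ ν : Measure Ω) (ε δ : ℝ) : Prop :=
  ∀ S : Set Ω, MeasurableSet S →
    μ S ≤ ENNReal.ofReal (Real.exp ε) * ν S + ENNReal.ofReal δ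

/-- Matrices in `{0,1}^{n × n}`; row `i` is the neighbor list of user `i`. -/
abbrev BitMatrix (n : ℕ) : Type := Matrix (Fin n) (Fin n) Bool

/-- The two matrices differ in exactly one bit. -/
def DifferInOneBit {n : ℕ} (A A' : BitMatrix n) : Prop :=
  ∃ i j, A i j ≠ A' i j ∧ ∀ k l, (k, l) ≠ (i, j) → A k l = A' k l

/-- The two graphs differ in exactly one edge. -/
def DifferInOneEdge {n : ℕ} (G G' : SimpleGraph (Fin n)) : Prop :=
  ∃ e : Sym2 (Fin n), symmDiff G.edgeSet G'.edgeSet = {e}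

open Classical in
/-- The adjacency matrix of a graph. -/
def adjacency {n : ℕ} (G : SimpleGraph (Fin n)) : BitMatrix n :=
  fun i j => decide (G.Adj i j)

/-- `(ε, δ)`-element DP; a randomized algorithm is given by the law of its output on each input. -/
def ElementDP {n : ℕ} {Ω : Type*} [MeasurableSpace Ω] (M : BitMatrix n → Measure Ω)
    (ε δ : ℝ) : Prop :=
  ∀ A A' : BitMatrix n, DifferInOneBit A A' → Indist (M A) (M A') ε δ

/-- `(ε, δ)`-edge DP. -/
def EdgeDP {n : ℕ} {Ω : Type*} [MeasurableSpace Ω] (M : BitMatrix n → Measure Ω)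
    (ε δ : ℝ) : Prop :=
  ∀ G G' : SimpleGraph (Fin n), DifferInOneEdge G G' →
    Indist (M (adjacency G)) (M (adjacency G')) ε δ

/-! ### Sources of randomness -/

/-- Warner's randomized response: keep the bit with probability `e^ε / (e^ε + 1)`,
flip it with probability `1 / (e^ε + 1)`. -/
def warnerRR (ε : ℝ) (x : Bool) : PMF Bool :=
  PMF.ofFintype
    (fun y => ENNReal.ofReal
      (if x = y then Real.exp ε / (Real.exp ε + 1) else 1 / (Real.exp ε + 1)))
    (by
      have h : 0 < Real.exp ε := Real.exp_pos ε
      have h1 : Real.exp ε / (Real.exp ε + 1) + 1 / (Real.exp ε + 1) = 1 := by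
        field_simp
      cases x
      · simp only [Fintype.sum_bool]
        rw [← ENNReal.ofReal_add (by split_ifs <;> positivity) (by split_ifs <;> positivity)]
        simp only [Bool.false_eq_true, if_false, if_true]
        rw [add_comm, h1, ENNReal.ofReal_one]
      · simp only [Fintype.sum_bool]
        rw [← ENNReal.ofReal_add (by split_ifs <;> positivity) (by split_ifs <;> positivity)]
        simp only [Bool.true_eq_false, if_false, if_true]
        rw [h1, ENNReal.ofReal_one])

/-- The joint law of independent samples from finitely many laws on finite types. -/
def independent {ι : Type*} [Fintype ι] [DecidableEq ι] {β : ι → Type*} [∀ i, Fintype (β i)]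
    (p : ∀ i, PMF (β i)) : PMF (∀ i, β i) :=
  PMF.ofFintype (fun x => ∏ i, p i (x i)) (by
    rw [← Fintype.prod_sum]
    refine Finset.prod_eq_one fun i _ => ?_
    rw [← tsum_fintype (L := .unconditional (β i)), PMF.tsum_coe])

/-- The Laplace distribution with mean `m` and scale `b > 0`. -/
def laplace (m b : ℝ) : Measure ℝ :=
  volume.withDensity fun x => ENNReal.ofReal (1 / (2 * b) * Real.exp (-|x - m| / b))

/-! ### Wedge shuffling, with and without local edges -/

/-- The users other than `i` and `j`. -/
abbrev Others {n : ℕ} (i j : Fin n) : Type := {k : Fin n // k ≠ i ∧ k ≠ j}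

/-- Wedge shuffling: every user `k ≠ i, j` applies randomized response to her wedge indicator
`a_{k,i} a_{k,j}`, and the shuffler permutes the noisy bits uniformly at random. -/
def wedgeShuffle {n : ℕ} (A : BitMatrix n) (εL : ℝ) (i j : Fin n) :
    PMF (Others i j → Bool) :=
  (independent fun k : Others i j => warnerRR εL (A k i && A k j)).bind fun y =>
    (PMF.uniformOfFintype (Equiv.Perm (Others i j))).map fun π => fun k => y (π k)

/-- What the data collector receives in one call for the pair `(i, j)`: the shuffled noisy
wedges and the two noisy local edges `z_i`, `z_j`. -/
abbrev PairMessages {n : ℕ} (i j : Fin n) : Type := (Others i j → Bool) × Bool × Bool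

/-- The messages of wedge shuffling with local edges for the pair `(i, j)`: wedges with budget
`εL`, and `a_{i,j}` (sent by `i`) and `a_{j,i}` (sent by `j`) with budget `ε`, independently. -/
def wsle {n : ℕ} (A : BitMatrix n) (ε εL : ℝ) (i j : Fin n) : PMF (PairMessages i j) :=
  (wedgeShuffle A εL i j).bind fun y =>
    (warnerRR ε (A i j)).bind fun zi =>
      (warnerRR ε (A j i)).map fun zj => (y, zi, zj)

/-- The flip probability of Warner's randomized response. -/
def flipProb (ε : ℝ) : ℝ := 1 / (Real.exp ε + 1)

/-- A bit as the real number `0` or `1`. -/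
def bit (b : Bool) : ℝ := if b then 1 else 0

/-- The estimate of the number of triangles that involve the pair `(i, j)`. -/
def pairEstimate {n : ℕ} (ε εL : ℝ) {i j : Fin n} (m : PairMessages i j) : ℝ :=
  (bit m.2.1 + bit m.2.2 - 2 * flipProb ε) * (∑ k, (bit (m.1 k) - flipProb εL)) /
    (2 * (1 - 2 * flipProb ε) * (1 - 2 * flipProb εL))

/-! ### The local privacy budget -/

/-- The closed-form privacy amplification bound for `m` shuffled users. -/
def closedFormEps (m : ℕ) (εL δ : ℝ) : ℝ :=
  Real.log (1 + (Real.exp εL - 1) / (Real.exp εL + 1) *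
    (8 * Real.sqrt (Real.exp εL * Real.log (4 / δ)) / Real.sqrt m + 8 * Real.exp εL / m))

/-- `ε` is the closed-form upper bound, in the regime where that bound is available. -/
def ClosedFormBound (m : ℕ) (εL δ ε : ℝ) : Prop :=
  0 < m ∧ 0 < δ ∧ εL ≤ Real.log (m / (16 * Real.log (2 / δ))) ∧ ε = closedFormEps m εL δ

/-- The binomial distribution, with the success probability clipped to `[0, 1]`. -/
def binomialPMF (k : ℕ) (p : ℝ) : PMF ℕ :=
  (ProbabilityTheory.binomial k (Set.projIcc 0 1 zero_le_one p)).toPMF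

/-- With `C ∼ Bin(m - 1, e^{-εL})`, `A ∼ Bin(C, 1/2)` and `B` the randomized response to `b`
(so `B ∼ Ber(e^{εL} / (e^{εL} + 1))` for `b = true`, and `B` is distributed as the complement
of that for `b = false`), the law of `(A + B, C - A + (1 - B))`. -/
def cloneCounts (m : ℕ) (εL : ℝ) (b : Bool) : PMF (ℕ × ℕ) :=
  (binomialPMF (m - 1) (Real.exp (-εL))).bind fun C =>
    (binomialPMF C (1 / 2)).bind fun A =>
      (warnerRR εL b).map fun B => (A + B.toNat, C - A + (!B).toNat)

/-- `ε` is a numerical upper bound: the pair of count distributions to which privacy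
amplification by shuffling is numerically reduced is `(ε, δ)`-indistinguishable. -/
def NumericalBound (m : ℕ) (εL δ ε : ℝ) : Prop :=
  Indist (cloneCounts m εL true).toMeasure (cloneCounts m εL false).toMeasure ε δ ∧
  Indist (cloneCounts m εL false).toMeasure (cloneCounts m εL true).toMeasure ε δ

/-- `εL` is a possible value of the local privacy budget computed from `n`, `ε`, `δ`: `ε` is
the closed-form or a numerical upper bound for `n - 2` shuffled users with budget `εL`. -/
def IsLocalPrivacyBudget (n : ℕ) (ε δ εL : ℝ) : Prop :=
  0 ≤ εL ∧ (ClosedFormBound (n - 2) εL δ ε ∨ NumericalBound (n - 2) εL δ ε)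

/-! ### The variance-reduced triangle counting algorithm -/

/-- First user of the `s`-th sampled pair, `σ(2s)` for `s = 0, …, t - 1`. -/
def fstUser {n t : ℕ} (ht : 2 * t ≤ n) (σ : Equiv.Perm (Fin n)) (s : Fin t) : Fin n :=
  σ ⟨2 * s, by omega⟩

/-- Second user of the `s`-th sampled pair, `σ(2s + 1)`. -/
def sndUser {n t : ℕ} (ht : 2 * t ≤ n) (σ : Equiv.Perm (Fin n)) (s : Fin t) : Fin n :=
  σ ⟨2 * s + 1, by omega⟩

/-- The sampled permutation together with the messages for the `t` sampled pairs. -/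
def AllPairMessages {n t : ℕ} (ht : 2 * t ≤ n) : Type :=
  Σ σ : Equiv.Perm (Fin n), ∀ s : Fin t, PairMessages (fstUser ht σ s) (sndUser ht σ s)

instance {n t : ℕ} (ht : 2 * t ≤ n) : MeasurableSpace (AllPairMessages ht) := ⊤

instance {n t : ℕ} (ht : 2 * t ≤ n) : Finite (AllPairMessages ht) :=
  inferInstanceAs (Finite (Σ σ : Equiv.Perm (Fin n),
    ∀ s : Fin t, PairMessages (fstUser ht σ s) (sndUser ht σ s)))

/-- Sample a uniform permutation and run wedge shuffling with local edges, with independent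
randomness, on each of the `t` disjoint pairs. -/
def allPairMessages {n t : ℕ} (ht : 2 * t ≤ n) (A : BitMatrix n) (ε εL : ℝ) :
    PMF (AllPairMessages ht) :=
  (PMF.uniformOfFintype (Equiv.Perm (Fin n))).bind fun σ =>
    (independent fun s : Fin t =>
      wsle A ε εL (fstUser ht σ s) (sndUser ht σ s)).map (Sigma.mk σ)

/-- The degree of user `i`, computed from her neighbor list. -/
def degree {n : ℕ} (A : BitMatrix n) (i : Fin n) : ℝ := ∑ j, bit (A i j)

/-- Everything the data collector sees: the sampled pairs, the messages for these pairs, and the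
noisy degrees `d_i + Lap(1/ε₁)` of all users. -/
abbrev Transcript {n t : ℕ} (ht : 2 * t ≤ n) : Type := AllPairMessages ht × (Fin n → ℝ)

/-- The law of the transcript. -/
def transcriptLaw {n t : ℕ} (ht : 2 * t ≤ n) (ε₁ ε₂ εL : ℝ) (A : BitMatrix n) :
    Measure (Transcript ht) :=
  (allPairMessages ht A ε₂ εL).toMeasure.prod
    (Measure.pi fun i => laplace (degree A i) (1 / ε₁))

/-- The variance-reduced estimate of the triangle count: only the pairs whose two noisy degrees
both exceed the threshold, `c` times the average noisy degree, are counted. -/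
def estimate {n t : ℕ} (ht : 2 * t ≤ n) (ε₂ εL c : ℝ) (T : Transcript ht) : ℝ :=
  let threshold := c * ((1 / n : ℝ) * ∑ i, T.2 i)
  (n * (n - 1) / (6 * t) : ℝ) *
    ∑ s : Fin t,
      if threshold < min (T.2 (fstUser ht T.1.1 s)) (T.2 (sndUser ht T.1.1 s)) then
        pairEstimate ε₂ εL (T.1.2 s)
      else 0

theorem measurable_estimate {n t : ℕ} (ht : 2 * t ≤ n) (ε₂ εL c : ℝ) :
    Measurable (estimate ht ε₂ εL c) := by
  refine measurable_from_prod_countable_right fun x => ?_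
  unfold estimate
  refine Measurable.const_mul (Finset.measurable_sum _ fun s _ => ?_) _
  refine Measurable.ite ?_ (measurable_const (a := pairEstimate ε₂ εL (x.2 s))) measurable_const
  exact measurableSet_lt (by fun_prop) ((measurable_pi_apply (fstUser ht x.1 s)).min
    (measurable_pi_apply (sndUser ht x.1 s)))

/-- The algorithm: the law of the estimate that the data collector outputs. -/
def algorithm {n t : ℕ} (ht : 2 * t ≤ n) (ε₁ ε₂ εL c : ℝ) (A : BitMatrix n) : Measure ℝ :=
  (transcriptLaw ht ε₁ ε₂ εL A).map (estimate ht ε₂ εL c)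

end WedgeShuffle

end

noncomputable section

namespace WedgeShuffle

open MeasureTheory
open scoped ENNReal

namespace Indist

variable {Ω Ω' : Type*} [MeasurableSpace Ω] [MeasurableSpace Ω']

theorem mono {μ ν : Measure Ω} {ε ε' δ δ' : ℝ} (h : Indist μ ν ε δ) (hε : ε ≤ ε') (hδ : δ ≤ δ') :
    Indist μ ν ε' δ' := fun S hS =>
  (h S hS).trans (add_le_add (mul_le_mul_left (ENNReal.ofReal_le_ofReal (Real.exp_le_exp.2 hε)) _)
    (ENNReal.ofReal_le_ofReal hδ))

theorem refl (μ : Measure Ω) : Indist μ μ 0 0 := fun S _ => by simp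

/-- Post-processing. -/
theorem map {μ ν : Measure Ω} {ε δ : ℝ} (h : Indist μ ν ε δ) {f : Ω → Ω'} (hf : Measurable f) :
    Indist (μ.map f) (ν.map f) ε δ := fun S hS => by
  rw [Measure.map_apply hf hS, Measure.map_apply hf hS]
  exact h _ (hf hS)

/-- Indistinguishability for tests with values in `[0, 1]`. -/
theorem lintegral_le {μ ν : Measure Ω} {ε δ : ℝ} (h : Indist μ ν ε δ) {f : Ω → ℝ≥0∞}
    (hf : Measurable f) (hf1 : ∀ x, f x ≤ 1) :
    ∫⁻ x, f x ∂μ ≤ ENNReal.ofReal (Real.exp ε) * ∫⁻ x, f x ∂ν + ENNReal.ofReal δ := by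
  have layer : ∀ κ : Measure Ω, ∫⁻ x, f x ∂κ =
      ∫⁻ t in Set.Ioo (0 : ℝ) 1, κ {x | t < (f x).toReal} := by
    intro κ
    have hreal : ∀ x, f x = ENNReal.ofReal (f x).toReal := fun x =>
      (ENNReal.ofReal_toReal ((hf1 x).trans_lt ENNReal.one_lt_top).ne).symm
    rw [lintegral_congr hreal, lintegral_eq_lintegral_meas_lt κ
      (Filter.Eventually.of_forall fun x => ENNReal.toReal_nonneg) hf.ennreal_toReal.aemeasurable]
    have hsplit : Set.Ioi (0 : ℝ) = Set.Ioo 0 1 ∪ Set.Ici 1 := by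
      ext t; simp only [Set.mem_Ioi, Set.mem_union, Set.mem_Ioo, Set.mem_Ici]
      constructor
      · intro h; rcases lt_or_ge t 1 with h' | h'
        · exact Or.inl ⟨h, h'⟩
        · exact Or.inr h'
      · rintro (h | h)
        · exact h.1
        · linarith
    rw [hsplit, lintegral_union measurableSet_Ici
      (Set.disjoint_left.2 fun t ht ht' => not_le.2 ht.2 ht')]
    have hzero : ∫⁻ t in Set.Ici (1 : ℝ), κ {x | t < (f x).toReal} = 0 := by
      rw [setLIntegral_congr_fun (g := fun _ => 0) measurableSet_Ici, lintegral_zero]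
      intro t ht
      have : {x | t < (f x).toReal} = ∅ := by
        ext x
        simp only [Set.mem_ofPred_eq, Set.mem_empty_iff_false, iff_false, not_lt]
        exact (ENNReal.toReal_mono ENNReal.one_ne_top (hf1 x)).trans (by simpa using ht)
      simp [this]
    rw [hzero, add_zero]
  rw [layer μ, layer ν]
  calc ∫⁻ t in Set.Ioo (0 : ℝ) 1, μ {x | t < (f x).toReal}
      ≤ ∫⁻ t in Set.Ioo (0 : ℝ) 1, (ENNReal.ofReal (Real.exp ε) * ν {x | t < (f x).toReal} +
          ENNReal.ofReal δ) :=
        lintegral_mono fun t => h _ (measurableSet_lt measurable_const hf.ennreal_toReal)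
    _ = _ := by
        rw [lintegral_add_right _ measurable_const, lintegral_const_mul' _ _ ENNReal.ofReal_ne_top]
        simp

/-- Composition of two independent mechanisms. -/
theorem prod {μ₁ ν₁ : Measure Ω} {μ₂ ν₂ : Measure Ω'} [IsProbabilityMeasure μ₁]
    [IsProbabilityMeasure ν₁] [IsProbabilityMeasure μ₂] [IsProbabilityMeasure ν₂]
    {ε₁ ε₂ δ₁ δ₂ : ℝ} (hδ₁ : 0 ≤ δ₁) (hδ₂ : 0 ≤ δ₂)
    (h₁ : Indist μ₁ ν₁ ε₁ δ₁) (h₂ : Indist μ₂ ν₂ ε₂ δ₂) :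
    Indist (μ₁.prod μ₂) (ν₁.prod ν₂) (ε₁ + ε₂) (δ₁ + δ₂) := by
  intro S hS
  rw [Measure.prod_apply hS, Measure.prod_apply hS]
  set e : ℝ≥0∞ := ENNReal.ofReal (Real.exp ε₂)
  have hmeas : Measurable fun x => e * ν₂ (Prod.mk x ⁻¹' S) :=
    (measurable_measure_prodMk_left hS).const_mul e
  calc ∫⁻ x, μ₂ (Prod.mk x ⁻¹' S) ∂μ₁
      ≤ ∫⁻ x, (min 1 (e * ν₂ (Prod.mk x ⁻¹' S)) + ENNReal.ofReal δ₂) ∂μ₁ := by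
        refine lintegral_mono fun x => ?_
        rcases le_total 1 (e * ν₂ (Prod.mk x ⁻¹' S)) with h | h
        · simp only [min_eq_left h]
          exact prob_le_one.trans le_self_add
        · simp only [min_eq_right h]
          exact h₂ _ (measurable_prodMk_left hS)
    _ = ∫⁻ x, min 1 (e * ν₂ (Prod.mk x ⁻¹' S)) ∂μ₁ + ENNReal.ofReal δ₂ := by
        rw [lintegral_add_right _ measurable_const]; simp
    _ ≤ (ENNReal.ofReal (Real.exp ε₁) * ∫⁻ x, min 1 (e * ν₂ (Prod.mk x ⁻¹' S)) ∂ν₁ +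
          ENNReal.ofReal δ₁) + ENNReal.ofReal δ₂ :=
        add_le_add_left (h₁.lintegral_le (measurable_const.min hmeas) fun x => min_le_left _ _) _
    _ ≤ (ENNReal.ofReal (Real.exp ε₁) * ∫⁻ x, e * ν₂ (Prod.mk x ⁻¹' S) ∂ν₁ +
          ENNReal.ofReal δ₁) + ENNReal.ofReal δ₂ := by
        gcongr; exact min_le_right _ _
    _ = _ := by
        rw [lintegral_const_mul _ (measurable_measure_prodMk_left hS), Real.exp_add,
          ENNReal.ofReal_mul (Real.exp_pos _).le, ENNReal.ofReal_add hδ₁ hδ₂, add_assoc, mul_assoc]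

/-- Composition of finitely many independent mechanisms. -/
theorem pi {m : ℕ} {α : Fin m → Type*} [∀ i, MeasurableSpace (α i)] {μ ν : ∀ i, Measure (α i)}
    [∀ i, IsProbabilityMeasure (μ i)] [∀ i, IsProbabilityMeasure (ν i)] {ε δ : Fin m → ℝ}
    (hδ : ∀ i, 0 ≤ δ i) (h : ∀ i, Indist (μ i) (ν i) (ε i) (δ i)) :
    Indist (Measure.pi μ) (Measure.pi ν) (∑ i, ε i) (∑ i, δ i) := by
  induction m with
  | zero =>
    have : Measure.pi μ = Measure.pi ν := by
      rw [Measure.pi_of_empty μ, Measure.pi_of_empty ν]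
    rw [this]
    simpa using Indist.refl (Measure.pi ν)
  | succ m ih =>
    rw [Fin.sum_univ_succ, Fin.sum_univ_succ]
    have key := (h 0).prod (hδ 0) (Finset.sum_nonneg fun i _ => hδ (Fin.succ i))
      (ih (fun i => hδ i.succ) fun i => h i.succ)
    have := key.map (MeasurableEquiv.piFinSuccAbove α 0).symm.measurable
    have hμ := (measurePreserving_piFinSuccAbove μ 0).symm.map_eq
    have hν := (measurePreserving_piFinSuccAbove ν 0).symm.map_eq
    simp only [Fin.succAbove_zero] at hμ hν
    rw [← hμ, ← hν]
    exact this

/-- Mixtures with common weights. -/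
theorem bind {α : Type*} (p : PMF α) {f g : α → PMF Ω} {ε δ : ℝ}
    (h : ∀ a, Indist (f a).toMeasure (g a).toMeasure ε δ) :
    Indist (p.bind f).toMeasure (p.bind g).toMeasure ε δ := by
  intro S hS
  rw [PMF.toMeasure_bind_apply _ _ _ hS, PMF.toMeasure_bind_apply _ _ _ hS]
  calc ∑' a, p a * (f a).toMeasure S
      ≤ ∑' a, p a * (ENNReal.ofReal (Real.exp ε) * (g a).toMeasure S + ENNReal.ofReal δ) :=
        ENNReal.tsum_le_tsum fun a => mul_le_mul_right (h a S hS) _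
    _ = _ := by
        simp_rw [mul_add, ENNReal.tsum_add, ENNReal.tsum_mul_right, PMF.tsum_coe, one_mul,
          mul_left_comm _ (ENNReal.ofReal (Real.exp ε)), ENNReal.tsum_mul_left]

end Indist

theorem toMeasure_independent {ι : Type*} [Fintype ι] [DecidableEq ι] {β : ι → Type*}
    [∀ i, Fintype (β i)] [∀ i, MeasurableSpace (β i)] [∀ i, MeasurableSingletonClass (β i)]
    (p : ∀ i, PMF (β i)) :
    (independent p).toMeasure = Measure.pi fun i => (p i).toMeasure := by
  refine Measure.ext_of_singleton fun x => ?_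
  rw [Measure.pi_singleton, PMF.toMeasure_apply_singleton _ _ (measurableSet_singleton x)]
  simp_rw [PMF.toMeasure_apply_singleton _ _ (measurableSet_singleton _)]
  rfl

theorem lintegral_exp_neg_mul_abs {a : ℝ} (ha : 0 < a) :
    ∫⁻ x : ℝ, ENNReal.ofReal (a / 2 * Real.exp (-(a * |x|))) = 1 := by
  have hval : ∫ x : ℝ, a / 2 * Real.exp (-(a * |x|)) = 1 := by
    rw [integral_comp_abs (f := fun y => a / 2 * Real.exp (-(a * y))), integral_const_mul]
    have := integral_exp_mul_Ioi (neg_lt_zero.2 ha) 0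
    simp only [neg_mul] at this
    rw [this]
    simp only [mul_zero, neg_zero, Real.exp_zero]
    field_simp
  have hint : Integrable fun x : ℝ => a / 2 * Real.exp (-(a * |x|)) :=
    not_imp_comm.1 integral_undef (by rw [hval]; exact one_ne_zero)
  rw [← ofReal_integral_eq_lintegral_ofReal hint
    (Filter.Eventually.of_forall fun x => by positivity), hval, ENNReal.ofReal_one]

instance isProbabilityMeasure_laplace (m : ℝ) {b : ℝ} [Fact (0 < b)] :
    IsProbabilityMeasure (laplace m b) := by
  have hb : 0 < b := Fact.out
  refine ⟨?_⟩
  rw [laplace, withDensity_apply _ MeasurableSet.univ, Measure.restrict_univ]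
  rw [lintegral_sub_right_eq_self (fun x => ENNReal.ofReal (1 / (2 * b) * Real.exp (-|x| / b))) m]
  rw [← lintegral_exp_neg_mul_abs (inv_pos.2 hb)]
  congr! 4 with x
  · field_simp
  · field_simp

theorem indist_laplace {m m' b : ℝ} (hb : 0 < b) :
    Indist (laplace m b) (laplace m' b) (|m - m'| / b) 0 := by
  intro S hS
  rw [laplace, laplace, withDensity_apply _ hS, withDensity_apply _ hS,
    ← lintegral_const_mul' _ _ ENNReal.ofReal_ne_top, ENNReal.ofReal_zero, add_zero]
  refine lintegral_mono fun x => ?_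
  rw [← ENNReal.ofReal_mul (Real.exp_pos _).le]
  refine ENNReal.ofReal_le_ofReal ?_
  rw [mul_left_comm, ← Real.exp_add, ← add_div]
  gcongr
  have := abs_sub_abs_le_abs_sub (x - m') (x - m)
  rw [sub_sub_sub_cancel_left] at this
  linarith

/-! ### The closed form is a numerical upper bound -/

theorem exp_neg_le_quadratic {x : ℝ} (hx : 0 ≤ x) : Real.exp (-x) ≤ 1 - x + x ^ 2 / 2 := by
  have h := Real.quadratic_le_exp_of_nonneg hx
  rw [Real.exp_neg, inv_le_iff_one_le_mul₀ (Real.exp_pos x)]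
  calc (1 : ℝ) ≤ (1 - x + x ^ 2 / 2) * (1 + x + x ^ 2 / 2) := by nlinarith [sq_nonneg (x ^ 2)]
    _ ≤ (1 - x + x ^ 2 / 2) * Real.exp x := by
      gcongr; nlinarith [sq_nonneg (x - 1)]

theorem exp_le_quadratic {x : ℝ} (hx : 0 ≤ x) (hx1 : x ≤ 1) : Real.exp x ≤ 1 + x + x ^ 2 := by
  have := (abs_le.1 (Real.abs_exp_sub_one_sub_id_le (x := x) (by rwa [abs_of_nonneg hx]))).2
  linarith

/-- The Chernoff exponent beats `log (1 / δ)`. -/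
theorem chernoff_exponent {s L μ η : ℝ} (hs : 0 ≤ s) (hμ : 0 < μ) (hsL : s ^ 2 * μ = L)
    (hL : 2 * Real.log 2 ≤ L) (hμL : 16 * (L - Real.log 2) ≤ μ) (hη : 8 * s ≤ η) :
    L - 2 * Real.log 2 + s / 2 ≤
      10 / 11 * μ * (1 - (Real.exp (s / 2) + Real.exp (-(s / 2 * (1 + η)))) / 2) := by
  have hl1 := Real.log_two_gt_d9
  have hl2 := Real.log_two_lt_d9
  have hs2 : s ^ 2 * (16 * (L - Real.log 2)) ≤ L := by
    rw [← hsL]; rw [← hsL] at hμL; gcongr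
  have hs8 : s ^ 2 ≤ 1 / 8 := by
    by_contra! h
    nlinarith
  have hs1 : s ≤ 0.354 := by nlinarith
  have e1 := exp_le_quadratic (x := s / 2) (by positivity) (by linarith)
  have e2 : Real.exp (-(s / 2 * (1 + η))) ≤ Real.exp (-(s / 2 * (1 + 8 * s))) := by
    gcongr
  have e3 := exp_neg_le_quadratic (x := s / 2 * (1 + 8 * s)) (by positivity)
  have e4 : s ^ 2 * ((15 / 4 - (1 + 8 * s) ^ 2 / 8) / 2) ≤
      1 - (Real.exp (s / 2) + Real.exp (-(s / 2 * (1 + η)))) / 2 := by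
    nlinarith
  have e5 : 10 / 11 * L * ((15 / 4 - (1 + 8 * s) ^ 2 / 8) / 2) ≤
      10 / 11 * μ * (1 - (Real.exp (s / 2) + Real.exp (-(s / 2 * (1 + η)))) / 2) := by
    calc 10 / 11 * L * ((15 / 4 - (1 + 8 * s) ^ 2 / 8) / 2)
        = 10 / 11 * μ * (s ^ 2 * ((15 / 4 - (1 + 8 * s) ^ 2 / 8) / 2)) := by rw [← hsL]; ring
      _ ≤ _ := by gcongr
  refine le_trans ?_ e5
  rcases le_total L 8 with h8 | h8
  · have : 0.95 ≤ (15 / 4 - (1 + 8 * s) ^ 2 / 8) / 2 := by nlinarith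
    nlinarith
  · have hs3 : s ^ 2 ≤ 0.07 := by
      by_contra! h
      nlinarith
    have hs4 : s ≤ 0.27 := by nlinarith
    have : 1.1 ≤ (15 / 4 - (1 + 8 * s) ^ 2 / 8) / 2 := by nlinarith
    nlinarith

theorem chernoff_tail {m : ℕ} {εL δ : ℝ} (hεL0 : 0 ≤ εL) (hm : 0 < m) (hδ : 0 < δ) (hδ1 : δ ≤ 1)
    (hεL : εL ≤ Real.log (m / (16 * Real.log (2 / δ)))) :
    ∃ l : ℝ, 0 ≤ l ∧ Real.exp l * (Real.exp (-εL) * ((Real.exp l + Real.exp (-(l * (1 +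
      (8 * Real.sqrt (Real.exp εL * Real.log (4 / δ)) / Real.sqrt m + 8 * Real.exp εL / m))))) / 2)
        + (1 - Real.exp (-εL))) ^ (m - 1) ≤ δ := by
  set p := Real.exp (-εL) with hp
  set η := 8 * Real.sqrt (Real.exp εL * Real.log (4 / δ)) / Real.sqrt m + 8 * Real.exp εL / m
    with hη
  have hmR : (0 : ℝ) < m := by exact_mod_cast hm
  have hl2 := Real.log_two_gt_d9
  have hp0 : 0 < p := Real.exp_pos _
  have hlog2 : Real.log (2 / δ) = Real.log 2 - Real.log δ := Real.log_div two_ne_zero hδ.ne'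
  have hlog4 : Real.log (4 / δ) = 2 * Real.log 2 - Real.log δ := by
    rw [Real.log_div (by norm_num) hδ.ne', show (4 : ℝ) = 2 ^ 2 by norm_num, Real.log_pow]
    norm_num
  have hδlog : Real.log δ ≤ 0 := Real.log_nonpos hδ.le hδ1
  set L := Real.log (4 / δ) with hL
  have hL0 : 0 < L := by linarith
  have hquot : 0 < m / (16 * Real.log (2 / δ)) := by
    apply div_pos hmR; linarith
  have hexp : Real.exp εL ≤ m / (16 * Real.log (2 / δ)) := by
    rw [← Real.exp_log hquot]; exact Real.exp_le_exp.2 hεL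
  have hpE : p * Real.exp εL = 1 := by rw [hp, ← Real.exp_add]; simp
  have hμL : 16 * (L - Real.log 2) ≤ p * m := by
    rw [le_div_iff₀ (by linarith)] at hexp
    have : L - Real.log 2 = Real.log (2 / δ) := by linarith
    rw [this]
    calc 16 * Real.log (2 / δ) = p * (Real.exp εL * (16 * Real.log (2 / δ))) := by
          rw [← mul_assoc, hpE, one_mul]
      _ ≤ p * m := by gcongr
  set s := Real.sqrt (Real.exp εL * L) / Real.sqrt m with hs
  have hs0 : 0 ≤ s := by positivity
  have hsL : s ^ 2 * (p * m) = L := by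
    rw [hs, div_pow, Real.sq_sqrt (by positivity), Real.sq_sqrt hmR.le]
    field_simp
    linear_combination hpE
  have hsη : 8 * s ≤ η := by
    rw [hη, hs, mul_div_assoc]
    have : 0 ≤ 8 * Real.exp εL / m := by positivity
    linarith
  have key := chernoff_exponent hs0 (by positivity) hsL (by linarith) hμL hsη
  refine ⟨s / 2, by positivity, ?_⟩
  set y := (Real.exp (s / 2) + Real.exp (-(s / 2 * (1 + η)))) / 2 with hy
  have hy0 : 0 < y := by positivity
  have hp1 : p ≤ 1 := Real.exp_le_one_iff.2 (by linarith)
  have hm11 : (11 : ℝ) ≤ m := by nlinarith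
  have hM : ((m - 1 : ℕ) : ℝ) = m - 1 := by push_cast [Nat.cast_sub (Nat.succ_le_of_lt hm)]; simp
  have hone : p * y + (1 - p) ≤ Real.exp (-(p * (1 - y))) := by
    have := Real.add_one_le_exp (-(p * (1 - y)))
    linarith
  have hy1 : 0 ≤ 1 - y := by
    by_contra! h
    have : 10 / 11 * (p * m) * (1 - y) ≤ 0 := mul_nonpos_of_nonneg_of_nonpos (by positivity) h.le
    nlinarith
  calc Real.exp (s / 2) * (p * y + (1 - p)) ^ (m - 1)
      ≤ Real.exp (s / 2) * Real.exp (-(p * (1 - y))) ^ (m - 1) := by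
        have : 0 ≤ p * y + (1 - p) := by nlinarith
        gcongr
    _ = Real.exp (s / 2 - (m - 1) * (p * (1 - y))) := by
        rw [← Real.exp_nat_mul, ← Real.exp_add, hM]; ring_nf
    _ ≤ Real.exp (Real.log δ) := by
        refine Real.exp_le_exp.2 ?_
        have : 10 / 11 * (p * m) * (1 - y) ≤ (m - 1) * (p * (1 - y)) := by
          nlinarith [mul_nonneg hp0.le hy1]
        nlinarith
    _ = δ := Real.exp_log hδ

/-- For `C` clones, the expectation of `f` under the counts, when the distinguished bit is `1` with
probability `α`, up to the factor `2 ^ C`. -/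
def cloneSum (C : ℕ) (α : ℝ) (f : ℕ → ℕ → ℝ) : ℝ :=
  ∑ A ∈ Finset.range (C + 1), (C.choose A : ℝ) * (α * f (A + 1) (C - A) + (1 - α) * f A (C - A + 1))

theorem cloneSum_swap (C : ℕ) (α : ℝ) (f : ℕ → ℕ → ℝ) :
    cloneSum C (1 - α) f = cloneSum C α fun a b => f b a := by
  rw [cloneSum, cloneSum, ← Finset.sum_range_reflect]
  refine Finset.sum_congr rfl fun A hA => ?_
  have hA : A ≤ C := Nat.lt_succ_iff.1 (Finset.mem_range.1 hA)
  have h1 : C + 1 - 1 - A = C - A := by omega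
  rw [h1, Nat.choose_symm hA, Nat.sub_sub_self hA]
  ring

theorem clone_pointwise {α η l p q a b : ℝ} (hα : 1 / 2 ≤ α) (hα1 : α ≤ 1) (hη : 0 ≤ η) (hl : 0 ≤ l)
    (hp : 0 ≤ p) (hq : 0 ≤ q) (hab : 0 < a + b) (hpq : p * b = q * a) :
    α * p + (1 - α) * q ≤ (1 + (2 * α - 1) * η) * ((1 - α) * p + α * q) +
      p * Real.exp (l * (a - (1 + η) * b)) := by
  have hdiff : α * p + (1 - α) * q - (1 + (2 * α - 1) * η) * ((1 - α) * p + α * q) =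
      (2 * α - 1) * (p * (1 - (1 - α) * η) - q * (1 + α * η)) := by ring
  rcases le_or_gt a ((1 + η) * b) with h | h
  · have hb : 0 < b := by
      by_contra! hb
      nlinarith
    have hpq' : p ≤ (1 + η) * q := by
      refine le_of_mul_le_mul_right ?_ hb
      rw [hpq]
      nlinarith
    have : p * (1 - (1 - α) * η) - q * (1 + α * η) ≤ 0 := by
      rcases le_total 0 (1 - (1 - α) * η) with h0 | h0
      · have := mul_le_mul_of_nonneg_right hpq' h0
        have h2 : 0 ≤ (1 - α) * (η ^ 2 * q) := mul_nonneg (by linarith) (by positivity)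
        nlinarith
      · have := mul_nonpos_of_nonneg_of_nonpos hp h0
        have : 0 ≤ q * (1 + α * η) := by positivity
        linarith
    have h3 := mul_nonpos_of_nonneg_of_nonpos (show 0 ≤ 2 * α - 1 by linarith) this
    have : 0 ≤ p * Real.exp (l * (a - (1 + η) * b)) := by positivity
    linarith
  · have hexp : 1 ≤ Real.exp (l * (a - (1 + η) * b)) :=
      Real.one_le_exp (mul_nonneg hl (by linarith))
    have h1 := mul_le_mul_of_nonneg_left hexp hp
    have h2 : 0 ≤ q * (1 + α * η) := by positivity
    have h3 : 0 ≤ p * ((1 - α) * η) := mul_nonneg hp (mul_nonneg (by linarith) hη)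
    have h4 : (2 * α - 1) * (p * (1 - (1 - α) * η) - q * (1 + α * η)) ≤ (2 * α - 1) * p :=
      mul_le_mul_of_nonneg_left (by linarith) (by linarith)
    have h5 : (2 * α - 1) * p ≤ 1 * p := mul_le_mul_of_nonneg_right (by linarith) hp
    linarith

theorem cloneSum_eq (C : ℕ) (α : ℝ) (f : ℕ → ℕ → ℝ) :
    cloneSum C α f = ∑ a ∈ Finset.range (C + 2),
      (α * (if a = 0 then 0 else (C.choose (a - 1) : ℝ)) + (1 - α) * C.choose a) *
        f a (C + 1 - a) := by
  simp_rw [cloneSum, mul_add, add_mul _ _ (f _ _), Finset.sum_add_distrib]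
  congr 1
  · rw [Finset.sum_range_succ' _ (C + 1)]
    simp only [Nat.add_eq_zero_iff, one_ne_zero, and_false, if_false, Nat.add_sub_cancel,
      if_true, mul_zero, zero_mul, add_zero]
    exact Finset.sum_congr rfl fun A _ => by rw [Nat.add_sub_add_right]; ring
  · rw [Finset.sum_range_succ _ (C + 1)]
    simp only [Nat.choose_succ_self, Nat.cast_zero, mul_zero, zero_mul, add_zero]
    refine Finset.sum_congr rfl fun A hA => ?_
    have : C + 1 - A = C - A + 1 := by have := Finset.mem_range.1 hA; omega
    rw [this]; ring

theorem cloneSum_le (C : ℕ) {α η l : ℝ} (hα : 1 / 2 ≤ α) (hα1 : α ≤ 1) (hη : 0 ≤ η) (hl : 0 ≤ l)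
    {f : ℕ → ℕ → ℝ} (hf0 : ∀ a b, 0 ≤ f a b) (hf1 : ∀ a b, f a b ≤ 1) :
    cloneSum C α f ≤ (1 + (2 * α - 1) * η) * cloneSum C (1 - α) f +
      Real.exp l * (Real.exp l + Real.exp (-(l * (1 + η)))) ^ C := by
  have htail : Real.exp l * (Real.exp l + Real.exp (-(l * (1 + η)))) ^ C =
      ∑ a ∈ Finset.range (C + 2), (if a = 0 then 0 else (C.choose (a - 1) : ℝ)) *
        Real.exp (l * (a - (1 + η) * ((C + 1 - a : ℕ) : ℝ))) := by
    rw [Finset.sum_range_succ', add_pow, Finset.mul_sum]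
    simp only [Nat.add_eq_zero_iff, one_ne_zero, and_false, if_false, Nat.add_sub_cancel,
      if_true, zero_mul, add_zero, Nat.add_sub_add_right]
    refine Finset.sum_congr rfl fun A hA => ?_
    rw [← Real.exp_nat_mul, ← Real.exp_nat_mul, ← mul_assoc, ← Real.exp_add, ← Real.exp_add,
      mul_comm]
    congr 2
    push_cast; ring
  rw [htail, cloneSum_eq, cloneSum_eq, Finset.mul_sum, ← Finset.sum_add_distrib]
  refine Finset.sum_le_sum fun a ha => ?_
  have haC : a ≤ C + 1 := Nat.lt_succ_iff.1 (Finset.mem_range.1 ha)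
  set p : ℝ := if a = 0 then 0 else (C.choose (a - 1) : ℝ) with hp
  have hp0 : 0 ≤ p := by rw [hp]; split_ifs <;> positivity
  have hb : ((C + 1 - a : ℕ) : ℝ) = C + 1 - a := by push_cast [Nat.cast_sub haC]; ring
  have hpq : p * ((C + 1 - a : ℕ) : ℝ) = (C.choose a : ℝ) * a := by
    rcases a with _ | a
    · simp [hp]
    · have := Nat.choose_succ_right_eq C a
      simp only [hp, Nat.add_eq_zero_iff, one_ne_zero, and_false, if_false, Nat.add_sub_cancel,
        Nat.add_sub_add_right]
      exact_mod_cast this.symm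
  have key := clone_pointwise (l := l) hα hα1 hη hl hp0 (Nat.cast_nonneg (C.choose a))
    (by rw [hb]; ring_nf; positivity) hpq
  have hE : 0 ≤ p * Real.exp (l * (a - (1 + η) * ((C + 1 - a : ℕ) : ℝ))) := by positivity
  calc _ ≤ ((1 + (2 * α - 1) * η) * ((1 - α) * p + α * C.choose a) +
      p * Real.exp (l * (a - (1 + η) * ((C + 1 - a : ℕ) : ℝ)))) * f a (C + 1 - a) :=
        mul_le_mul_of_nonneg_right key (hf0 _ _)
    _ ≤ _ := by
        have := mul_le_mul_of_nonneg_left (hf1 a (C + 1 - a)) hE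
        rw [sub_sub_cancel]
        nlinarith

/-- The expectation of `f` under the counts, for `M` users other than the distinguished one. -/
def cloneMean (M : ℕ) (p α : ℝ) (f : ℕ → ℕ → ℝ) : ℝ :=
  ∑ C ∈ Finset.range (M + 1), (M.choose C : ℝ) * p ^ C * (1 - p) ^ (M - C) *
    ((1 / 2) ^ C * cloneSum C α f)

theorem cloneMean_swap (M : ℕ) (p α : ℝ) (f : ℕ → ℕ → ℝ) :
    cloneMean M p (1 - α) f = cloneMean M p α fun a b => f b a := by
  simp_rw [cloneMean, cloneSum_swap]

theorem cloneMean_le (M : ℕ) {p α η l : ℝ} (hp : 0 ≤ p) (hp1 : p ≤ 1) (hα : 1 / 2 ≤ α)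
    (hα1 : α ≤ 1) (hη : 0 ≤ η) (hl : 0 ≤ l)
    {f : ℕ → ℕ → ℝ} (hf0 : ∀ a b, 0 ≤ f a b) (hf1 : ∀ a b, f a b ≤ 1) :
    cloneMean M p α f ≤ (1 + (2 * α - 1) * η) * cloneMean M p (1 - α) f +
      Real.exp l * (p * ((Real.exp l + Real.exp (-(l * (1 + η)))) / 2) + (1 - p)) ^ M := by
  have htail : Real.exp l * (p * ((Real.exp l + Real.exp (-(l * (1 + η)))) / 2) + (1 - p)) ^ M =
      ∑ C ∈ Finset.range (M + 1), (M.choose C : ℝ) * p ^ C * (1 - p) ^ (M - C) *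
        ((1 / 2) ^ C * (Real.exp l * (Real.exp l + Real.exp (-(l * (1 + η)))) ^ C)) := by
    rw [add_pow, Finset.mul_sum]
    refine Finset.sum_congr rfl fun C _ => ?_
    rw [mul_pow, div_pow, div_pow]; ring
  rw [htail, cloneMean, cloneMean, Finset.mul_sum, ← Finset.sum_add_distrib]
  refine Finset.sum_le_sum fun C _ => ?_
  have hw : 0 ≤ (M.choose C : ℝ) * p ^ C * (1 - p) ^ (M - C) * (1 / 2) ^ C := by
    have : 0 ≤ 1 - p := by linarith
    positivity
  have := mul_le_mul_of_nonneg_left (cloneSum_le C hα hα1 hη hl hf0 hf1) hw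
  nlinarith

/-! ### The counts as a probability mass function -/

theorem tsum_bind_mul {β γ : Type*} (p : PMF β) (g : β → PMF γ) (f : γ → ℝ≥0∞) :
    ∑' z, p.bind g z * f z = ∑' x, p x * ∑' z, g x z * f z := by
  simp_rw [PMF.bind_apply, ← ENNReal.tsum_mul_right, ← ENNReal.tsum_mul_left]
  rw [ENNReal.tsum_comm]
  simp_rw [mul_assoc]

theorem tsum_map_mul {β γ : Type*} (p : PMF β) (g : β → γ) (f : γ → ℝ≥0∞) :
    ∑' z, p.map g z * f z = ∑' x, p x * f (g x) := by
  rw [← PMF.bind_pure_comp, tsum_bind_mul]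
  congr! with x
  rw [tsum_eq_single (g x) fun z hz => by simp [hz]]
  simp

theorem tsum_binomialPMF_mul (k : ℕ) {p : ℝ} (hp : 0 ≤ p) (hp1 : p ≤ 1) (f : ℕ → ℝ≥0∞) :
    ∑' j, binomialPMF k p j * f j = ∑ j ∈ Finset.range (k + 1),
      ENNReal.ofReal ((k.choose j : ℝ) * p ^ j * (1 - p) ^ (k - j)) * f j := by
  have happ : ∀ j, binomialPMF k p j =
      ENNReal.ofReal ((k.choose j : ℝ) * p ^ j * (1 - p) ^ (k - j)) := by
    intro j
    rw [binomialPMF, Measure.toPMF_apply, ProbabilityTheory.binomial_singleton,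
      Set.projIcc_of_mem zero_le_one ⟨hp, hp1⟩]
  simp_rw [happ]
  refine tsum_eq_sum fun j hj => ?_
  rw [Nat.choose_eq_zero_of_lt (by simpa using hj)]
  simp

theorem tsum_cloneCounts_mul (m : ℕ) {εL : ℝ} (hεL : 0 ≤ εL) (b : Bool) (f : ℕ × ℕ → ℝ≥0∞) :
    ∑' z, cloneCounts m εL b z * f z = ∑ C ∈ Finset.range (m - 1 + 1),
      ENNReal.ofReal (((m - 1).choose C : ℝ) * Real.exp (-εL) ^ C *
        (1 - Real.exp (-εL)) ^ (m - 1 - C)) *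
      ∑ A ∈ Finset.range (C + 1), ENNReal.ofReal ((C.choose A : ℝ) * (1 / 2) ^ C) *
        ∑ B, warnerRR εL b B * f (A + B.toNat, C - A + (!B).toNat) := by
  rw [cloneCounts, tsum_bind_mul, tsum_binomialPMF_mul _ (Real.exp_pos _).le
    (Real.exp_le_one_iff.2 (by linarith))]
  refine Finset.sum_congr rfl fun C _ => ?_
  rw [tsum_bind_mul, tsum_binomialPMF_mul _ (by norm_num) (by norm_num)]
  congr 1
  refine Finset.sum_congr rfl fun A hA => ?_
  rw [tsum_map_mul, tsum_fintype]
  congr 2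
  rw [mul_assoc, show (1 : ℝ) - 1 / 2 = 1 / 2 by norm_num, ← pow_add]
  congr 2
  have := Finset.mem_range.1 hA
  omega

theorem lintegral_toMeasure {β : Type*} [MeasurableSpace β] [Countable β]
    [MeasurableSingletonClass β] (p : PMF β) (f : β → ℝ≥0∞) :
    ∫⁻ x, f x ∂p.toMeasure = ∑' x, p x * f x := by
  rw [lintegral_countable']
  simp_rw [PMF.toMeasure_apply_singleton _ _ (measurableSet_singleton _), mul_comm]

theorem cloneCounts_apply (m : ℕ) {εL : ℝ} (hεL : 0 ≤ εL) (b : Bool) (S : Set (ℕ × ℕ)) :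
    (cloneCounts m εL b).toMeasure S = ENNReal.ofReal (cloneMean (m - 1) (Real.exp (-εL))
      (if b then Real.exp εL / (Real.exp εL + 1) else 1 - Real.exp εL / (Real.exp εL + 1))
      fun x y => S.indicator 1 (x, y)) := by
  have hE := Real.exp_pos εL
  have hp1 : 0 ≤ 1 - Real.exp (-εL) := by
    rw [sub_nonneg]; exact Real.exp_le_one_iff.2 (by linarith)
  have hf : ∀ z, 0 ≤ S.indicator (1 : ℕ × ℕ → ℝ) z := fun z =>
    Set.indicator_nonneg (fun _ _ => zero_le_one) z
  set α := if b then Real.exp εL / (Real.exp εL + 1) else 1 - Real.exp εL / (Real.exp εL + 1)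
    with hα
  have hα0 : 0 ≤ α := by
    rw [hα]; split_ifs
    · positivity
    · rw [sub_nonneg, div_le_one (by positivity)]; linarith
  have hα1 : 0 ≤ 1 - α := by
    rw [hα]; split_ifs
    · rw [sub_nonneg, div_le_one (by positivity)]; linarith
    · rw [sub_sub_cancel]; positivity
  have hw1 : warnerRR εL b true = ENNReal.ofReal α := by
    rw [warnerRR, PMF.ofFintype_apply, hα]
    cases b
    · congr 1; simp; field_simp; simp
    · simp
  have hw0 : warnerRR εL b false = ENNReal.ofReal (1 - α) := by
    rw [warnerRR, PMF.ofFintype_apply, hα]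
    cases b
    · simp
    · congr 1; simp; field_simp; simp
  have hS : (cloneCounts m εL b).toMeasure S =
      ∑' z, cloneCounts m εL b z * ENNReal.ofReal (S.indicator 1 z) := by
    rw [PMF.toMeasure_apply_eq_tsum]
    congr! with z
    by_cases hz : z ∈ S <;> simp [hz]
  rw [hS, tsum_cloneCounts_mul m hεL, cloneMean, ENNReal.ofReal_sum_of_nonneg]
  · refine Finset.sum_congr rfl fun C _ => ?_
    rw [ENNReal.ofReal_mul (mul_nonneg (mul_nonneg (Nat.cast_nonneg _)
      (pow_nonneg (Real.exp_pos _).le _)) (pow_nonneg hp1 _))]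
    congr 1
    rw [cloneSum, Finset.mul_sum, ENNReal.ofReal_sum_of_nonneg]
    · refine Finset.sum_congr rfl fun A _ => ?_
      rw [← mul_assoc, mul_comm ((1 / 2 : ℝ) ^ C),
        ENNReal.ofReal_mul (p := (C.choose A : ℝ) * (1 / 2) ^ C) (by positivity),
        ENNReal.ofReal_add (mul_nonneg hα0 (hf _)) (mul_nonneg hα1 (hf _)),
        ENNReal.ofReal_mul hα0, ENNReal.ofReal_mul hα1]
      simp [hw0, hw1]
    · intro A _
      exact mul_nonneg (by positivity) (mul_nonneg (by positivity)
        (add_nonneg (mul_nonneg hα0 (hf _)) (mul_nonneg hα1 (hf _))))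
  · intro C _
    refine mul_nonneg (by positivity) (mul_nonneg (by positivity) (Finset.sum_nonneg fun A _ => ?_))
    exact mul_nonneg (by positivity)
      (add_nonneg (mul_nonneg hα0 (hf _)) (mul_nonneg hα1 (hf _)))

theorem numericalBound_of_closedFormBound {m : ℕ} {εL δ ε : ℝ} (hεL : 0 ≤ εL) (hδ : δ ≤ 1)
    (h : ClosedFormBound m εL δ ε) : NumericalBound m εL δ ε := by
  obtain ⟨hm, hδ0, hle, rfl⟩ := h
  obtain ⟨l, hl, htail⟩ := chernoff_tail hεL hm hδ0 hδ hle
  have hE := Real.exp_pos εL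
  have hE1 := Real.one_le_exp hεL
  set η := 8 * Real.sqrt (Real.exp εL * Real.log (4 / δ)) / Real.sqrt m + 8 * Real.exp εL / m
    with hη
  have hη0 : 0 ≤ η := by positivity
  set α := Real.exp εL / (Real.exp εL + 1) with hα
  have hα2 : 1 / 2 ≤ α := by rw [hα, div_le_div_iff₀ (by norm_num) (by positivity)]; linarith
  have hα1 : α ≤ 1 := by rw [hα, div_le_one (by positivity)]; linarith
  have hγ : (Real.exp εL - 1) / (Real.exp εL + 1) = 2 * α - 1 := by rw [hα]; field_simp; ring
  have hg : 0 ≤ (2 * α - 1) * η := mul_nonneg (by linarith) hη0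
  have hexp : Real.exp (closedFormEps m εL δ) = 1 + (2 * α - 1) * η := by
    rw [closedFormEps, hγ, Real.exp_log (by linarith)]
  have main : ∀ f : ℕ → ℕ → ℝ, (∀ a b, 0 ≤ f a b) → (∀ a b, f a b ≤ 1) →
      cloneMean (m - 1) (Real.exp (-εL)) α f ≤
        Real.exp (closedFormEps m εL δ) * cloneMean (m - 1) (Real.exp (-εL)) (1 - α) f + δ := by
    intro f hf0 hf1
    rw [hexp]
    exact (cloneMean_le (m - 1) (Real.exp_pos _).le (Real.exp_le_one_iff.2 (by linarith))
      hα2 hα1 hη0 hl hf0 hf1).trans (by gcongr)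
  have hf0 : ∀ (S : Set (ℕ × ℕ)) z, 0 ≤ S.indicator (1 : ℕ × ℕ → ℝ) z := fun S z =>
    Set.indicator_nonneg (fun _ _ => zero_le_one) z
  have hf1 : ∀ (S : Set (ℕ × ℕ)) z, S.indicator (1 : ℕ × ℕ → ℝ) z ≤ 1 := fun S z =>
    Set.indicator_le_self' (fun _ _ => zero_le_one) z
  constructor
  all_goals
    intro S _
    rw [cloneCounts_apply m hεL, cloneCounts_apply m hεL, ← ENNReal.ofReal_mul (Real.exp_pos _).le]
    refine (ENNReal.ofReal_le_ofReal ?_).trans ENNReal.ofReal_add_le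
    simp only [if_true, Bool.false_eq_true, if_false]
  · exact main _ (fun _ _ => hf0 S _) fun _ _ => hf1 S _
  · have := main (fun x y => S.indicator 1 (y, x)) (fun _ _ => hf0 S _) fun _ _ => hf1 S _
    rw [← cloneMean_swap] at this
    rwa [← cloneMean_swap (f := fun x y => S.indicator 1 (x, y)), sub_sub_cancel] at this

section Amplification

open Polynomial

/-! ### Privacy amplification by shuffling for randomized response -/

/-- The linear functional on generating polynomials that sends `X ^ n` to `h n`. -/
def countFunctional (h : ℕ → ℝ≥0∞) : ℝ≥0∞[X] →ₗ[ℝ≥0∞] ℝ≥0∞ :=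
  Polynomial.lsum fun n => h n • LinearMap.id

theorem countFunctional_C_mul_X_pow (h : ℕ → ℝ≥0∞) (a : ℝ≥0∞) (n : ℕ) :
    countFunctional h (C a * X ^ n) = a * h n := by
  rw [countFunctional, lsum_apply, C_mul_X_pow_eq_monomial, sum_monomial_index _ _ (by simp)]
  simp [mul_comm]

theorem countFunctional_C_mul (h : ℕ → ℝ≥0∞) (a : ℝ≥0∞) (p : ℝ≥0∞[X]) :
    countFunctional h (C a * p) = a * countFunctional h p := by
  rw [← smul_eq_C_mul, map_smul, smul_eq_mul]

theorem countFunctional_le {h : ℕ → ℝ≥0∞} (hh : ∀ n, h n ≤ 1) (p : ℝ≥0∞[X]) :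
    countFunctional h p ≤ p.eval 1 := by
  rw [countFunctional, lsum_apply, eval_eq_sum]
  refine Finset.sum_le_sum fun n _ => ?_
  simpa using mul_le_mul_left (hh n) (p.coeff n)

/-- The generating polynomial of a law on bits. -/
def bitPoly (w : Bool → ℝ≥0∞) : ℝ≥0∞[X] := C (w false) + C (w true) * X

theorem sum_prod_mul_count {ι : Type*} [Fintype ι] [DecidableEq ι] (w : ι → Bool → ℝ≥0∞)
    (h : ℕ → ℝ≥0∞) :
    ∑ y : ι → Bool, (∏ k, w k (y k)) * h (∑ k, (y k).toNat) =
      countFunctional h (∏ k, bitPoly (w k)) := by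
  have : ∀ k, bitPoly (w k) = ∑ b : Bool, C (w k b) * X ^ b.toNat := by
    intro k; simp [bitPoly, add_comm]
  simp_rw [this]
  rw [Fintype.prod_sum, map_sum]
  refine Finset.sum_congr rfl fun y _ => ?_
  rw [Finset.prod_mul_distrib, Finset.prod_pow_eq_pow_sum, ← map_prod,
    countFunctional_C_mul_X_pow]

/-- The law of a randomized response conditioned on not being replaced by a uniform bit. -/
def leftOver (ε : ℝ) (x y : Bool) : ℝ≥0∞ :=
  ENNReal.ofReal (if x = y then (2 * Real.exp ε + 1) / (2 * (Real.exp ε + 1))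
    else 1 / (2 * (Real.exp ε + 1)))

theorem eval_one_leftOver (ε : ℝ) (x : Bool) : (bitPoly (leftOver ε x)).eval 1 = 1 := by
  have h := Real.exp_pos ε
  have h1 : (2 * Real.exp ε + 1) / (2 * (Real.exp ε + 1)) + 1 / (2 * (Real.exp ε + 1)) = 1 := by
    field_simp; ring
  simp only [bitPoly, eval_add, eval_C, eval_mul, eval_X, mul_one, leftOver]
  rw [← ENNReal.ofReal_add (by split_ifs <;> positivity) (by split_ifs <;> positivity)]
  cases x
  · rw [if_pos rfl, if_neg (by simp), h1, ENNReal.ofReal_one]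
  · rw [if_neg (by simp), if_pos rfl, add_comm, h1, ENNReal.ofReal_one]

theorem warnerRR_eq_mixture {ε : ℝ} (hε : 0 ≤ ε) (x y : Bool) :
    warnerRR ε x y = ENNReal.ofReal (Real.exp (-ε)) * ENNReal.ofReal (1 / 2) +
      ENNReal.ofReal (1 - Real.exp (-ε)) * leftOver ε x y := by
  have h := Real.exp_pos ε
  have hq : 0 ≤ 1 - Real.exp (-ε) := by
    rw [sub_nonneg]; exact Real.exp_le_one_iff.2 (by linarith)
  rw [warnerRR, PMF.ofFintype_apply, leftOver, ← ENNReal.ofReal_mul (Real.exp_pos _).le,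
    ← ENNReal.ofReal_mul hq, ← ENNReal.ofReal_add (by positivity)
      (mul_nonneg hq (by split_ifs <;> positivity)), Real.exp_neg]
  congr 1
  split_ifs
  · field_simp; ring
  · field_simp; ring

theorem bitPoly_warnerRR {ε : ℝ} (hε : 0 ≤ ε) (x : Bool) :
    bitPoly (warnerRR ε x) = C (ENNReal.ofReal (Real.exp (-ε))) *
      (C (ENNReal.ofReal (1 / 2)) * (1 + X)) +
      C (ENNReal.ofReal (1 - Real.exp (-ε))) * bitPoly (leftOver ε x) := by
  rw [bitPoly, bitPoly, warnerRR_eq_mixture hε x false, warnerRR_eq_mixture hε x true]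
  simp only [C_add, C_mul]
  ring

theorem exists_perm_of_sum_toNat_eq {ι : Type*} [Fintype ι] {y y' : ι → Bool}
    (h : ∑ k, (y k).toNat = ∑ k, (y' k).toNat) : ∃ τ : Equiv.Perm ι, y' = fun k => y (τ k) := by
  have hcard : ∀ z : ι → Bool, ∑ k, (z k).toNat = Fintype.card {k // z k = true} := by
    intro z
    rw [Fintype.card_subtype, Finset.card_filter]
    exact Finset.sum_congr rfl fun k _ => by cases z k <;> rfl
  rw [hcard, hcard] at h
  let e : {k // y' k = true} ≃ {k // y k = true} := Fintype.equivOfCardEq h.symm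
  refine ⟨e.extendSubtype, funext fun k => ?_⟩
  by_cases hk : y' k = true
  · rw [hk, e.extendSubtype_mem k hk]
  · have := e.extendSubtype_not_mem k hk
    rw [Bool.not_eq_true] at hk this
    rw [hk, this]

/-- A permutation-invariant function of a bit vector depends only on the number of ones. -/
theorem exists_eq_comp_count {ι : Type*} [Fintype ι] (g : (ι → Bool) → ℝ≥0∞)
    (hg : ∀ y, g y ≤ 1) (hinv : ∀ y (τ : Equiv.Perm ι), g (fun k => y (τ k)) = g y) :
    ∃ h : ℕ → ℝ≥0∞, (∀ n, h n ≤ 1) ∧ ∀ y, g y = h (∑ k, (y k).toNat) := by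
  classical
  refine ⟨fun n => if hn : ∃ y : ι → Bool, ∑ k, (y k).toNat = n then g hn.choose else 0,
    fun n => ?_, fun y => ?_⟩
  · dsimp only
    split_ifs with hn
    · exact hg _
    · exact zero_le_one
  · have hn : ∃ y' : ι → Bool, ∑ k, (y' k).toNat = ∑ k, (y k).toNat := ⟨y, rfl⟩
    simp only [dif_pos hn]
    obtain ⟨τ, hτ⟩ := exists_perm_of_sum_toNat_eq hn.choose_spec
    exact (congrArg g hτ).trans (hinv _ τ)

variable {ι : Type*} [DecidableEq ι]

/-- The generating polynomial of the contribution of the users in `s` that are not clones, averaged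
over the set of `c` clones. -/
def leftOverPoly (s : Finset ι) (ε : ℝ) (x : ι → Bool) (c : ℕ) : ℝ≥0∞[X] :=
  C ((s.card.choose c : ℝ≥0∞)⁻¹) *
    ∑ T ∈ s.powersetCard c, ∏ k ∈ s \ T, bitPoly (leftOver ε (x k))

theorem eval_one_leftOverPoly_le (s : Finset ι) (ε : ℝ) (x : ι → Bool) (c : ℕ) :
    (leftOverPoly s ε x c).eval 1 ≤ 1 := by
  simp only [leftOverPoly, eval_mul, eval_C, eval_finsetSum, eval_prod, eval_one_leftOver,
    Finset.prod_const_one, Finset.sum_const, Finset.card_powersetCard, nsmul_eq_mul, mul_one]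
  exact ENNReal.inv_mul_le_one _

theorem prod_bitPoly_warnerRR {ε : ℝ} (hε : 0 ≤ ε) (s : Finset ι) (x : ι → Bool) :
    ∏ k ∈ s, bitPoly (warnerRR ε (x k)) = ∑ c ∈ Finset.range (s.card + 1),
      C (ENNReal.ofReal ((s.card.choose c : ℝ) * Real.exp (-ε) ^ c *
        (1 - Real.exp (-ε)) ^ (s.card - c))) *
      ∑ a ∈ Finset.range (c + 1), C (ENNReal.ofReal ((c.choose a : ℝ) * (1 / 2) ^ c)) *
        (X ^ a * leftOverPoly s ε x c) := by
  have hq : 0 ≤ 1 - Real.exp (-ε) := by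
    rw [sub_nonneg]; exact Real.exp_le_one_iff.2 (by linarith)
  simp_rw [bitPoly_warnerRR hε]
  rw [Finset.prod_add, Finset.sum_powerset]
  refine Finset.sum_congr rfl fun c hc => ?_
  have hc : c ≤ s.card := Nat.lt_succ_iff.1 (Finset.mem_range.1 hc)
  have hhalf : ∑ a ∈ Finset.range (c + 1), C (ENNReal.ofReal ((c.choose a : ℝ) * (1 / 2) ^ c)) *
      (X ^ a * leftOverPoly s ε x c) =
      (C (ENNReal.ofReal (1 / 2)) * (1 + X)) ^ c * leftOverPoly s ε x c := by
    rw [mul_pow, add_comm (1 : ℝ≥0∞[X]), add_pow, Finset.mul_sum, Finset.sum_mul]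
    refine Finset.sum_congr rfl fun a _ => ?_
    rw [ENNReal.ofReal_mul (by positivity), ENNReal.ofReal_natCast,
      ENNReal.ofReal_pow (by positivity), C_mul, C_pow, one_pow, map_natCast]
    ring
  rw [hhalf, leftOverPoly]
  have hch : (s.card.choose c : ℝ≥0∞) * (s.card.choose c : ℝ≥0∞)⁻¹ = 1 :=
    ENNReal.mul_inv_cancel (by exact_mod_cast (Nat.choose_pos hc).ne') (ENNReal.natCast_ne_top _)
  have hch' : C (s.card.choose c : ℝ≥0∞) * C (s.card.choose c : ℝ≥0∞)⁻¹ = 1 := by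
    rw [← C_mul, hch, C_1]
  rw [ENNReal.ofReal_mul (by positivity), ENNReal.ofReal_mul (by positivity),
    ENNReal.ofReal_natCast, ENNReal.ofReal_pow (Real.exp_pos _).le, ENNReal.ofReal_pow hq,
    C_mul, C_mul, C_pow, C_pow]
  trans C (ENNReal.ofReal (Real.exp (-ε))) ^ c * C (ENNReal.ofReal (1 - Real.exp (-ε))) ^
      (s.card - c) * (C (ENNReal.ofReal (1 / 2)) * (1 + X)) ^ c *
      ∑ T ∈ s.powersetCard c, ∏ k ∈ s \ T, bitPoly (leftOver ε (x k))
  · rw [Finset.mul_sum]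
    refine Finset.sum_congr rfl fun T hT => ?_
    obtain ⟨hTs, hTc⟩ := Finset.mem_powersetCard.1 hT
    rw [Finset.prod_const, hTc, mul_pow (C (ENNReal.ofReal (Real.exp (-ε)))),
      Finset.prod_mul_distrib, Finset.prod_const,
      Finset.card_sdiff_of_subset hTs, hTc]
    ring
  · rw [← one_mul (_ * _ * _ * _), ← hch']
    ring

/-- Randomized responses of all users, uniformly shuffled. -/
def shuffledRR [Fintype ι] (ε : ℝ) (x : ι → Bool) : PMF (ι → Bool) :=
  (independent fun k => warnerRR ε (x k)).bind fun y =>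
    (PMF.uniformOfFintype (Equiv.Perm ι)).map fun π => fun k => y (π k)

/-- The probability that a uniform shuffle of `y` lies in `S` depends only on the number of ones. -/
theorem exists_shuffle_prob [Fintype ι] (S : Set (ι → Bool)) :
    ∃ h : ℕ → ℝ≥0∞, (∀ n, h n ≤ 1) ∧ ∀ y : ι → Bool,
      ((PMF.uniformOfFintype (Equiv.Perm ι)).map fun π => fun k => y (π k)).toMeasure S =
        h (∑ k, (y k).toNat) := by
  refine exists_eq_comp_count (fun y => ((PMF.uniformOfFintype (Equiv.Perm ι)).map
    fun π => fun k => y (π k)).toMeasure S) (fun y => prob_le_one) fun y τ => ?_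
  have hmap : ((PMF.uniformOfFintype (Equiv.Perm ι)).map fun π => fun k => y (τ (π k))) =
      (PMF.uniformOfFintype (Equiv.Perm ι)).map fun π => fun k => y (π k) := by
    ext z
    rw [PMF.map_apply, PMF.map_apply, tsum_fintype, tsum_fintype]
    refine Fintype.sum_equiv (Equiv.mulLeft τ) _ _ fun π => ?_
    simp [Equiv.Perm.mul_apply]
  simp only [hmap]

/-- The shuffled reports are a randomized post-processing, which does not depend on the input of
user `k₀`, of the clone counts. -/
theorem shuffledRR_apply [Fintype ι] {ε : ℝ} (hε : 0 ≤ ε) (x : ι → Bool) (k₀ : ι)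
    {S : Set (ι → Bool)} {h : ℕ → ℝ≥0∞}
    (hS : ∀ y : ι → Bool,
      ((PMF.uniformOfFintype (Equiv.Perm ι)).map fun π => fun k => y (π k)).toMeasure S =
        h (∑ k, (y k).toNat)) :
    (shuffledRR ε x).toMeasure S = ∑' z, cloneCounts (Fintype.card ι) ε (x k₀) z *
      countFunctional h (X ^ z.1 *
        leftOverPoly (Finset.univ.erase k₀) ε x (z.1 + z.2 - 1)) := by
  have hcard : (Finset.univ.erase k₀).card = Fintype.card ι - 1 := by
    rw [Finset.card_erase_of_mem (Finset.mem_univ _), Finset.card_univ]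
  rw [shuffledRR, PMF.toMeasure_bind_apply _ _ _ (Set.toFinite S).measurableSet, tsum_fintype]
  simp_rw [hS]
  rw [show (∑ y, (independent fun k => warnerRR ε (x k)) y * h (∑ k, (y k).toNat)) = _ from
    sum_prod_mul_count (fun k => warnerRR ε (x k)) h,
    ← Finset.mul_prod_erase _ _ (Finset.mem_univ k₀), prod_bitPoly_warnerRR hε, hcard,
    tsum_cloneCounts_mul _ hε, Finset.mul_sum, map_sum]
  refine Finset.sum_congr rfl fun c _ => ?_
  rw [mul_left_comm, countFunctional_C_mul, Finset.mul_sum, map_sum]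
  congr 1
  refine Finset.sum_congr rfl fun a ha => ?_
  have ha : a ≤ c := Nat.lt_succ_iff.1 (Finset.mem_range.1 ha)
  rw [mul_left_comm, countFunctional_C_mul, bitPoly, add_mul, map_add, mul_assoc,
    countFunctional_C_mul, countFunctional_C_mul, Fintype.sum_bool, add_comm]
  have h1 : a + 1 + (c - a) - 1 = c := by omega
  have h0 : a + (c - a + 1) - 1 = c := by omega
  simp only [Bool.toNat_true, Bool.toNat_false, Bool.not_true, Bool.not_false, h1, h0, pow_succ',
    add_zero, mul_assoc]

theorem indist_shuffledRR [Fintype ι] {εL ε δ : ℝ} (hεL : 0 ≤ εL)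
    (hnum : NumericalBound (Fintype.card ι) εL δ ε) {x x' : ι → Bool} {k₀ : ι}
    (h₀ : x k₀ ≠ x' k₀) (hx : ∀ k, k ≠ k₀ → x k = x' k) :
    Indist (shuffledRR εL x).toMeasure (shuffledRR εL x').toMeasure ε δ := by
  intro S _
  obtain ⟨h, hh, hS⟩ := exists_shuffle_prob S
  have hpoly : ∀ c, leftOverPoly (Finset.univ.erase k₀) εL x' c =
      leftOverPoly (Finset.univ.erase k₀) εL x c := by
    intro c
    rw [leftOverPoly, leftOverPoly]
    congr 1
    refine Finset.sum_congr rfl fun T _ => Finset.prod_congr rfl fun k hk => ?_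
    rw [hx k (Finset.ne_of_mem_erase (Finset.mem_sdiff.1 hk).1)]
  rw [shuffledRR_apply hεL x k₀ hS, shuffledRR_apply hεL x' k₀ hS]
  simp_rw [hpoly, ← lintegral_toMeasure]
  have hle : ∀ z : ℕ × ℕ, countFunctional h (X ^ z.1 *
      leftOverPoly (Finset.univ.erase k₀) εL x (z.1 + z.2 - 1)) ≤ 1 := fun z =>
    (countFunctional_le hh _).trans (by simpa using eval_one_leftOverPoly_le _ _ _ _)
  have hb : x' k₀ = !x k₀ := by cases hxk : x k₀ <;> cases hxk' : x' k₀ <;> simp_all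
  rw [hb]
  cases x k₀
  · exact hnum.2.lintegral_le (measurable_of_countable _) hle
  · exact hnum.1.lintegral_le (measurable_of_countable _) hle

end Amplification

/-! ### One pair of users -/

theorem indist_warnerRR {ε : ℝ} (hε : 0 ≤ ε) (x x' : Bool) :
    Indist (warnerRR ε x).toMeasure (warnerRR ε x').toMeasure ε 0 := by
  intro S _
  have hE := Real.exp_pos ε
  have hE1 := Real.one_le_exp hε
  rw [PMF.toMeasure_apply_eq_tsum, PMF.toMeasure_apply_eq_tsum, ENNReal.ofReal_zero, add_zero,
    ← ENNReal.tsum_mul_left]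
  refine ENNReal.tsum_le_tsum fun y => ?_
  by_cases hy : y ∈ S
  · rw [Set.indicator_of_mem hy, Set.indicator_of_mem hy, warnerRR, warnerRR, PMF.ofFintype_apply,
      PMF.ofFintype_apply, ← ENNReal.ofReal_mul hE.le]
    refine ENNReal.ofReal_le_ofReal ?_
    have h1 : 1 / (Real.exp ε + 1) ≤ Real.exp ε / (Real.exp ε + 1) := by gcongr
    have h2 : Real.exp ε / (Real.exp ε + 1) = Real.exp ε * (1 / (Real.exp ε + 1)) := by ring
    have h3 : 0 < 1 / (Real.exp ε + 1) := by positivity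
    split_ifs <;> nlinarith
  · simp [Set.indicator_of_notMem hy]

theorem toMeasure_bind_map_mk {β γ : Type*} [MeasurableSpace β] [MeasurableSpace γ] [Countable β]
    [Countable γ] [MeasurableSingletonClass β] [MeasurableSingletonClass γ] (p : PMF β)
    (q : PMF γ) :
    (p.bind fun a => q.map (Prod.mk a)).toMeasure = p.toMeasure.prod q.toMeasure := by
  refine Measure.ext_of_singleton fun ⟨x, y⟩ => ?_
  rw [← Set.singleton_prod_singleton, Measure.prod_prod, Set.singleton_prod_singleton]
  simp_rw [PMF.toMeasure_apply_singleton _ _ (measurableSet_singleton _), PMF.bind_apply,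
    PMF.map_apply]
  rw [tsum_eq_single x, tsum_eq_single y]
  · simp
  · intro z hz; simp [hz.symm]
  · intro z hz; simp [hz.symm]

theorem toMeasure_wsle {n : ℕ} (A : BitMatrix n) (ε εL : ℝ) (i j : Fin n) :
    (wsle A ε εL i j).toMeasure = (wedgeShuffle A εL i j).toMeasure.prod
      ((warnerRR ε (A i j)).toMeasure.prod (warnerRR ε (A j i)).toMeasure) := by
  rw [← toMeasure_bind_map_mk, ← toMeasure_bind_map_mk, wsle]
  simp_rw [PMF.map_bind, PMF.map_comp]
  rfl

/-- Any two entries in which the matrices differ are equal or mutually transposed. -/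
def DifferInTransposes {n : ℕ} (A A' : BitMatrix n) : Prop :=
  ∀ k i k' j, A k i ≠ A' k i → A k' j ≠ A' k' j → (k = k' ∧ i = j) ∨ (k = j ∧ k' = i)

/-- `1` if the matrices differ in the entry `(k, l)`, and `0` otherwise. -/
def changed {n : ℕ} (A A' : BitMatrix n) (k l : Fin n) : ℕ := if A k l = A' k l then 0 else 1

theorem indist_warnerRR_changed {n : ℕ} (A A' : BitMatrix n) {ε : ℝ} (hε : 0 ≤ ε) (k l : Fin n) :
    Indist (warnerRR ε (A k l)).toMeasure (warnerRR ε (A' k l)).toMeasure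
      (changed A A' k l * ε) 0 := by
  by_cases h : A k l = A' k l
  · simpa [changed, h] using Indist.refl _
  · simpa [changed, h] using indist_warnerRR hε _ _

theorem card_others {n : ℕ} {i j : Fin n} (hij : i ≠ j) : Fintype.card (Others i j) = n - 2 := by
  rw [Fintype.card_subtype]
  have : (Finset.univ.filter fun k : Fin n => k ≠ i ∧ k ≠ j) = {i, j}ᶜ := by
    ext k; simp
  rw [this, Finset.card_compl, Finset.card_pair hij, Fintype.card_fin]

theorem indist_wsle {n : ℕ} {A A' : BitMatrix n} (hA : DifferInTransposes A A') {ε δ εL : ℝ}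
    (hε : 0 ≤ ε) (hδ : 0 ≤ δ) (hεL : 0 ≤ εL) (hnum : NumericalBound (n - 2) εL δ ε)
    {i j : Fin n} (hij : i ≠ j) :
    Indist (wsle A ε εL i j).toMeasure (wsle A' ε εL i j).toMeasure
      (((∑ k, changed A A' k i + ∑ k, changed A A' k j : ℕ) : ℝ) * ε)
      (((∑ k, changed A A' k i + ∑ k, changed A A' k j : ℕ) : ℝ) * δ) := by
  have hle : ∀ k l, changed A A' k l ≤ ∑ k, changed A A' k l := fun k l =>
    Finset.single_le_sum (f := fun k => changed A A' k l) (fun _ _ => Nat.zero_le _)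
      (Finset.mem_univ k)
  have hz := (indist_warnerRR_changed A A' hε i j).prod le_rfl le_rfl
    (indist_warnerRR_changed A A' hε j i)
  rw [toMeasure_wsle, toMeasure_wsle]
  by_cases hw : ∃ k : Others i j, (A k i && A k j) ≠ (A' k i && A' k j)
  · obtain ⟨k, hk⟩ := hw
    have split : ∀ k : Others i j, (A k i && A k j) ≠ (A' k i && A' k j) →
        A k i ≠ A' k i ∨ A k j ≠ A' k j := by
      intro k hk
      by_contra! h
      exact hk (by rw [h.1, h.2])
    have hki := k.2.1
    have hkj := k.2.2
    have hsh : Indist (wedgeShuffle A εL i j).toMeasure (wedgeShuffle A' εL i j).toMeasure ε δ := by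
      refine indist_shuffledRR (k₀ := k) hεL (by rwa [card_others hij]) hk fun k' hk' => ?_
      by_contra hne
      refine hk' (Subtype.ext ?_)
      have h' := k'.2
      rcases split k hk with h1 | h1 <;> rcases split k' hne with h2 | h2 <;>
        rcases hA _ _ _ _ h1 h2 with h3 | h3 <;> grind
    have h1 : changed A A' i j = 0 := by
      rw [changed, if_pos]
      by_contra hne
      rcases split k hk with h | h <;> rcases hA _ _ _ _ h hne with h3 | h3 <;> grind
    have h2 : changed A A' j i = 0 := by
      rw [changed, if_pos]
      by_contra hne
      rcases split k hk with h | h <;> rcases hA _ _ _ _ h hne with h3 | h3 <;> grind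
    rw [h1, h2] at hz
    have hone : 1 ≤ ∑ k, changed A A' k i + ∑ k, changed A A' k j := by
      have hi := hle k i
      have hj := hle k j
      rcases split k hk with h | h
      · rw [changed, if_neg h] at hi; omega
      · rw [changed, if_neg h] at hj; omega
    have hone' : (1 : ℝ) ≤ ((∑ k, changed A A' k i + ∑ k, changed A A' k j : ℕ) : ℝ) := by
      exact_mod_cast hone
    refine (hsh.prod hδ (by norm_num) hz).mono ?_ ?_
    · push_cast at hone' ⊢; nlinarith
    · push_cast at hone' ⊢; nlinarith
  · push Not at hw
    have hsh : wedgeShuffle A εL i j = wedgeShuffle A' εL i j := by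
      rw [wedgeShuffle, wedgeShuffle]
      simp_rw [hw]
    rw [hsh]
    refine ((Indist.refl _).prod le_rfl (by norm_num) hz).mono ?_ ?_
    · rw [zero_add, ← add_mul]
      refine mul_le_mul_of_nonneg_right ?_ hε
      have := add_le_add (hle j i) (hle i j)
      rw [add_comm]
      exact_mod_cast this
    · rw [zero_add, zero_add]; positivity

/-! ### All pairs, degrees, and the transcript -/

theorem sum_pairs_le {n t : ℕ} (ht : 2 * t ≤ n) (σ : Equiv.Perm (Fin n)) (N : Fin n → ℕ) :
    ∑ s : Fin t, (N (fstUser ht σ s) + N (sndUser ht σ s)) ≤ ∑ l, N l := by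
  have hinj : Function.Injective (Sum.elim (fstUser ht σ) (sndUser ht σ)) := by
    rintro (s | s) (s' | s') h <;>
      simp only [Sum.elim_inl, Sum.elim_inr, fstUser, sndUser, EmbeddingLike.apply_eq_iff_eq,
        Fin.mk.injEq] at h
    · exact congrArg Sum.inl (Fin.ext (by omega))
    · omega
    · omega
    · exact congrArg Sum.inr (Fin.ext (by omega))
  calc ∑ s : Fin t, (N (fstUser ht σ s) + N (sndUser ht σ s))
      = ∑ x : Fin t ⊕ Fin t, N (Sum.elim (fstUser ht σ) (sndUser ht σ) x) := by
        rw [Fintype.sum_sum_type, Finset.sum_add_distrib]; rfl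
    _ = ∑ l ∈ Finset.univ.map ⟨_, hinj⟩, N l := by rw [Finset.sum_map]; rfl
    _ ≤ ∑ l, N l := Finset.sum_le_sum_of_subset (Finset.subset_univ _)

theorem fstUser_ne_sndUser {n t : ℕ} (ht : 2 * t ≤ n) (σ : Equiv.Perm (Fin n)) (s : Fin t) :
    fstUser ht σ s ≠ sndUser ht σ s := by
  intro h
  have := σ.injective h
  simp at this

theorem indist_allPairMessages {n t : ℕ} (ht : 2 * t ≤ n) {A A' : BitMatrix n}
    (hA : DifferInTransposes A A') {ε δ εL : ℝ}
    (hε : 0 ≤ ε) (hδ : 0 ≤ δ) (hεL : 0 ≤ εL) (hnum : NumericalBound (n - 2) εL δ ε) :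
    Indist (allPairMessages ht A ε εL).toMeasure (allPairMessages ht A' ε εL).toMeasure
      (((∑ l, ∑ k, changed A A' k l : ℕ) : ℝ) * ε) (((∑ l, ∑ k, changed A A' k l : ℕ) : ℝ) * δ) := by
  refine Indist.bind _ fun σ => ?_
  let mk : (∀ s : Fin t, PairMessages (fstUser ht σ s) (sndUser ht σ s)) → AllPairMessages ht :=
    Sigma.mk (β := fun σ => ∀ s : Fin t, PairMessages (fstUser ht σ s) (sndUser ht σ s)) σ
  have hmk : Measurable mk := measurable_of_countable _
  change Indist ((independent fun s : Fin t =>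
      wsle A ε εL (fstUser ht σ s) (sndUser ht σ s)).map mk).toMeasure
    ((independent fun s : Fin t =>
      wsle A' ε εL (fstUser ht σ s) (sndUser ht σ s)).map mk).toMeasure _ _
  rw [← PMF.toMeasure_map _ _ hmk, ← PMF.toMeasure_map _ _ hmk]
  refine Indist.map ?_ hmk
  rw [toMeasure_independent, toMeasure_independent]
  have hsum := sum_pairs_le ht σ fun l => ∑ k, changed A A' k l
  refine (Indist.pi (fun s => ?_) fun s => indist_wsle hA hε hδ hεL hnum
    (fstUser_ne_sndUser ht σ s)).mono ?_ ?_
  · positivity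
  · rw [← Finset.sum_mul]
    exact mul_le_mul_of_nonneg_right (by exact_mod_cast hsum) hε
  · rw [← Finset.sum_mul]
    exact mul_le_mul_of_nonneg_right (by exact_mod_cast hsum) hδ

theorem abs_degree_sub_le {n : ℕ} (A A' : BitMatrix n) (i : Fin n) :
    |degree A i - degree A' i| ≤ ((∑ l, changed A A' i l : ℕ) : ℝ) := by
  rw [degree, degree, ← Finset.sum_sub_distrib, Nat.cast_sum]
  refine (Finset.abs_sum_le_sum_abs _ _).trans (Finset.sum_le_sum fun l _ => ?_)
  rw [changed, bit, bit]
  cases A i l <;> cases A' i l <;> simp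

theorem indist_transcriptLaw {n t : ℕ} (ht : 2 * t ≤ n) {A A' : BitMatrix n}
    (hA : DifferInTransposes A A') {ε₁ ε₂ δ εL : ℝ} (hε₁ : 0 < ε₁)
    (hε₂ : 0 ≤ ε₂) (hδ : 0 ≤ δ) (hεL : 0 ≤ εL) (hnum : NumericalBound (n - 2) εL δ ε₂) :
    Indist (transcriptLaw ht ε₁ ε₂ εL A) (transcriptLaw ht ε₁ ε₂ εL A')
      (((∑ l, ∑ k, changed A A' k l : ℕ) : ℝ) * (ε₁ + ε₂))
      (((∑ l, ∑ k, changed A A' k l : ℕ) : ℝ) * δ) := by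
  have : Fact (0 < 1 / ε₁) := ⟨by positivity⟩
  have hdeg := Indist.pi (fun _ => le_rfl) fun i =>
    indist_laplace (m := degree A i) (m' := degree A' i) (b := 1 / ε₁) this.out
  refine ((indist_allPairMessages ht hA hε₂ hδ hεL hnum).prod (by positivity)
    (Finset.sum_nonneg fun _ _ => le_rfl) hdeg).mono ?_ ?_
  · rw [mul_add, add_comm]
    refine add_le_add_left ?_ _
    rw [Finset.sum_comm, Nat.cast_sum, Finset.sum_mul]
    refine Finset.sum_le_sum fun i _ => ?_
    rw [div_div_eq_mul_div, div_one]
    exact mul_le_mul_of_nonneg_right (abs_degree_sub_le A A' i) hε₁.le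
  · simp

theorem differInTransposes_of_differInOneBit {n : ℕ} {A A' : BitMatrix n}
    (h : DifferInOneBit A A') :
    DifferInTransposes A A' ∧ ∑ l, ∑ k, changed A A' k l ≤ 1 := by
  obtain ⟨a, b, hab, hne⟩ := h
  have key : ∀ k l, A k l ≠ A' k l → k = a ∧ l = b := by
    intro k l hkl
    by_contra hc
    exact hkl (hne k l fun h => hc (Prod.ext_iff.1 h))
  refine ⟨fun k i k' j h1 h2 => ?_, ?_⟩
  · have := key _ _ h1; have := key _ _ h2
    grind
  · have hle : ∀ l k, changed A A' k l ≤ if l = b then (if k = a then 1 else 0) else 0 := by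
      intro l k
      have := key k l
      rw [changed]; split_ifs <;> grind
    calc _ ≤ ∑ l, ∑ k, (if l = b then (if k = a then 1 else 0) else 0) :=
          Finset.sum_le_sum fun l _ => Finset.sum_le_sum fun k _ => hle l k
      _ = 1 := by simp

theorem differInTransposes_of_differInOneEdge {n : ℕ} {G G' : SimpleGraph (Fin n)}
    (h : DifferInOneEdge G G') :
    DifferInTransposes (adjacency G) (adjacency G') ∧
      ∑ l, ∑ k, changed (adjacency G) (adjacency G') k l ≤ 2 := by
  obtain ⟨e, he⟩ := h
  induction e with | _ a b
  have key : ∀ k l, adjacency G k l ≠ adjacency G' k l → (k = a ∧ l = b) ∨ (k = b ∧ l = a) := by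
    intro k l hkl
    have hmem : s(k, l) ∈ symmDiff G.edgeSet G'.edgeSet := by
      rw [Set.mem_symmDiff, SimpleGraph.mem_edgeSet, SimpleGraph.mem_edgeSet]
      by_contra hc
      refine hkl ?_
      rw [adjacency, adjacency, decide_eq_decide]
      tauto
    rw [he, Set.mem_singleton_iff, Sym2.eq_iff] at hmem
    exact hmem
  refine ⟨fun k i k' j h1 h2 => ?_, ?_⟩
  · have := key _ _ h1; have := key _ _ h2
    grind
  · have hle : ∀ l k, changed (adjacency G) (adjacency G') k l ≤
        (if l = b then (if k = a then 1 else 0) else 0) +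
        if l = a then (if k = b then 1 else 0) else 0 := by
      intro l k
      have := key k l
      rw [changed]; split_ifs <;> grind
    calc _ ≤ ∑ l, ∑ k, ((if l = b then (if k = a then 1 else 0) else 0) +
          if l = a then (if k = b then 1 else 0) else 0) :=
          Finset.sum_le_sum fun l _ => Finset.sum_le_sum fun k _ => hle l k
      _ = 2 := by simp [Finset.sum_add_distrib]

end WedgeShuffle

end

theorem mainTheorem7 (n t : ℕ) (ht₁ : 1 ≤ t) (ht : 2 * t ≤ n)
    (ε₁ ε₂ δ c εL : ℝ) (hε₁ : 0 < ε₁) (hε₂ : 0 ≤ ε₂) (hδ₀ : 0 ≤ δ) (hδ₁ : δ ≤ 1) (hc : 0 ≤ c)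
    (hεL : WedgeShuffle.IsLocalPrivacyBudget n ε₂ δ εL) :
    (WedgeShuffle.ElementDP (WedgeShuffle.algorithm ht ε₁ ε₂ εL c) (ε₁ + ε₂) δ ∧
      WedgeShuffle.EdgeDP (WedgeShuffle.algorithm ht ε₁ ε₂ εL c) (2 * (ε₁ + ε₂)) (2 * δ)) ∧
    (WedgeShuffle.ElementDP (WedgeShuffle.transcriptLaw ht ε₁ ε₂ εL) (ε₁ + ε₂) δ ∧
      WedgeShuffle.EdgeDP (WedgeShuffle.transcriptLaw ht ε₁ ε₂ εL) (2 * (ε₁ + ε₂)) (2 * δ)) := by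
  obtain ⟨hεL0, hbound⟩ := hεL
  have hnum : WedgeShuffle.NumericalBound (n - 2) εL δ ε₂ :=
    hbound.elim (WedgeShuffle.numericalBound_of_closedFormBound hεL0 hδ₁) id
  have hsum : 0 ≤ ε₁ + ε₂ := by linarith
  have helem : WedgeShuffle.ElementDP (WedgeShuffle.transcriptLaw ht ε₁ ε₂ εL) (ε₁ + ε₂) δ := by
    intro A A' h
    obtain ⟨hA, hcard⟩ := WedgeShuffle.differInTransposes_of_differInOneBit h
    have hcard' : ((∑ l, ∑ k, WedgeShuffle.changed A A' k l : ℕ) : ℝ) ≤ 1 := by exact_mod_cast hcard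
    exact (WedgeShuffle.indist_transcriptLaw ht hA hε₁ hε₂ hδ₀ hεL0 hnum).mono
      (mul_le_of_le_one_left hsum hcard') (mul_le_of_le_one_left hδ₀ hcard')
  have hedge : WedgeShuffle.EdgeDP (WedgeShuffle.transcriptLaw ht ε₁ ε₂ εL)
      (2 * (ε₁ + ε₂)) (2 * δ) := by
    intro G G' h
    obtain ⟨hA, hcard⟩ := WedgeShuffle.differInTransposes_of_differInOneEdge h
    exact (WedgeShuffle.indist_transcriptLaw ht hA hε₁ hε₂ hδ₀ hεL0 hnum).mono
      (mul_le_mul_of_nonneg_right (by exact_mod_cast hcard) hsum)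
      (mul_le_mul_of_nonneg_right (by exact_mod_cast hcard) hδ₀)
  have hmeas := WedgeShuffle.measurable_estimate ht ε₂ εL c
  exact ⟨⟨fun A A' h => (helem A A' h).map hmeas, fun G G' h => (hedge G G' h).map hmeas⟩,
    helem, hedge⟩
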